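/- For an $n\times n$ matrix $A$ over $\mathbb F_2$ and $b\in\mathbb F_2^n$, the system $Ax=b$ is encoded as a CNF formula by replacing each of its equations $\bigoplus_{k\in S}x_k=a$ with the conjunction of all clauses that contain each variable $x_k$, $k\in S$, exactly once (possibly negated) and no other variable, and that are implied by the equation. For a set $I$ of rows of $A$, the boundary $\partial I$ is the set of columns that contain a one in exactly one row of $I$. The matrix $A$ is an $(r,s,c)$-boundary expander if every row has at most $s$ ones and $|\partial I|\ge c\,|I|$ for every set $I$ of at most $r$ rows. Fix $\beta>1$ and let all logarithms be to base $\beta$. For every constant $K$ there is a constant $C$ (depending only on $K$ and $\beta$) such that the following holds for every $n$. Let $A$ be an $n\times n$ matrix over $\mathbb F_2$ of full rank, with exactly three ones in each row and at most $K\log n$ ones in each column, which is an $(r,3,\tfrac{11}{13})$-boundary expander with $r=n/\log^{14}n$. For $b\in\mathbb F_2^n$ let $\Phi_{i,j;b}$ be the CNF formula encoding the system $Ax=b$ together with the additional equation $x_i\oplus x_j=0$. Call a pair of indices $(i,j)$ with $i<j$ bad if for some $b$ one can substitute a value in $\{0,1\}$ for a single variable of $\Phi_{i,j;b}$ so that the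 resulting formula is unsatisfiable and has a tree-like resolution refutation of size (number of clauses in the refutation tree) less than $2^{\frac{9r}{130}-3}$. Then the number of bad pairs is at most $C\,n\log^2 n$. -/

import Mathlib

namespace XorSys

/-! ### Clauses, CNF formulas, substitution -/

/-- A literal over the variables `V`: the pair `(v, a)` is the literal that is true exactly when
`x_v = a`. Thus `(v, 1)` is `x_v` and `(v, 0)` is the negation of `x_v`. -/
abbrev Literal (V : Type) : Type := V × ZMod 2

/-- A clause: a finite set of literals, read as their disjunction. -/
abbrev Clause (V : Type) : Type := Finset (Literal V)

/-- A CNF formula: a finite set of clauses, read as their conjunction. -/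
abbrev CNF (V : Type) : Type := Finset (Clause V)

/-- The assignment `x` satisfies some literal of the clause. -/
def Clause.SatisfiedBy {V : Type} (C : Clause V) (x : V → ZMod 2) : Prop :=
  ∃ l ∈ C, x l.1 = l.2

/-- Some assignment satisfies all the clauses. -/
def CNF.Satisfiable {V : Type} (F : CNF V) : Prop :=
  ∃ x : V → ZMod 2, ∀ C ∈ F, Clause.SatisfiedBy C x

/-- The formula obtained by substituting `a` for the variable `v`: clauses with a literal that
became true are dropped, and the literal that became false is removed from the other clauses. -/
def CNF.subst {V : Type} [DecidableEq V] (F : CNF V) (v : V) (a : ZMod 2) : CNF V :=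
  (F.filter (fun C => (v, a) ∉ C)).image (fun C => C.erase (v, a + 1))

/-! ### Tree-like resolution -/

/-- Tree-like resolution derivations of a clause from the formula `F`: the leaves are clauses of
`F`, and an inner node is the resolvent of its two children on some variable `v`. -/
inductive ResTree {V : Type} [DecidableEq V] (F : CNF V) : Clause V → Type
  | leaf (C : Clause V) (hC : C ∈ F) : ResTree F C
  | resolve (v : V) (C D : Clause V) (hC : (v, 1) ∈ C) (hD : (v, 0) ∈ D)
      (s : ResTree F C) (t : ResTree F D) :
      ResTree F (C.erase (v, 1) ∪ D.erase (v, 0))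

/-- The size of a derivation: the number of clauses (nodes) in the tree. -/
def ResTree.size {V : Type} [DecidableEq V] {F : CNF V} : {C : Clause V} → ResTree F C → ℕ
  | _, .leaf _ _ => 1
  | _, .resolve _ _ _ _ _ s t => s.size + t.size + 1

/-- A tree-like resolution refutation: a derivation of the empty clause. -/
abbrev Refutation {V : Type} [DecidableEq V] (F : CNF V) : Type := ResTree F ∅

/-! ### Linear systems over the two-element field as CNF formulas -/

/-- The columns in which row `i` contains a one. -/
def rowSupport {R V : Type} [Fintype V] (M : Matrix R V (ZMod 2)) (i : R) : Finset V :=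
  Finset.univ.filter (fun j => M i j = 1)

/-- The canonical CNF of the equation `⨁ v ∈ S, x_v = a`: one clause in the variables `S` for each
assignment to `S` that violates the equation, namely the clause excluding that assignment. -/
def parityCNF {V : Type} [Fintype V] [DecidableEq V] (S : Finset V) (a : ZMod 2) : CNF V :=
  (Finset.univ.filter (fun y : V → ZMod 2 => ∑ v ∈ S, y v ≠ a)).image
    (fun y => S.image (fun v => (v, y v + 1)))

/-- The CNF formula encoding the linear system `M x = b`. -/
def systemCNF {R V : Type} [Fintype R] [Fintype V] [DecidableEq V]
    (M : Matrix R V (ZMod 2)) (b : R → ZMod 2) : CNF V :=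
  Finset.univ.biUnion (fun i => parityCNF (rowSupport M i) (b i))

/-- The formula encoding `A x = b` together with the additional equation `x_i ⊕ x_j = 0`. -/
def extendedCNF {n : ℕ} (A : Matrix (Fin n) (Fin n) (ZMod 2)) (i j : Fin n)
    (b : Fin n → ZMod 2) : CNF (Fin n) :=
  systemCNF
    (Matrix.fromRows A (Matrix.of (fun (_ : Unit) => Pi.single i 1 + Pi.single j 1)))
    (Sum.elim b (fun _ => 0))

/-! ### Boundary expanders -/

/-- The boundary of a set of rows: the columns with a one in exactly one of these rows. -/
def boundary {R V : Type} [Fintype V] (M : Matrix R V (ZMod 2)) (I : Finset R) : Finset V :=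
  Finset.univ.filter (fun j => (I.filter (fun i => M i j = 1)).card = 1)

/-- `(r, s, c)`-boundary expanders. -/
def IsBoundaryExpander {R V : Type} [Fintype V] (M : Matrix R V (ZMod 2))
    (r : ℝ) (s : ℕ) (c : ℝ) : Prop :=
  (∀ i, (rowSupport M i).card ≤ s) ∧
    ∀ I : Finset R, (I.card : ℝ) ≤ r → c * (I.card : ℝ) ≤ ((boundary M I).card : ℝ)

/-- The expansion radius `n / log ^ 14 n`, with logarithms to base `β`. -/
noncomputable def radius (β : ℝ) (n : ℕ) : ℝ := (n : ℝ) / (Real.logb β n) ^ 14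

/-- The `n × n` Boolean matrices with full rank over the two-element field, exactly three ones in
each row, at most `K log n` ones in each column, that are
`(n / log ^ 14 n, 3, 11 / 13)`-boundary expanders; logarithms are to base `β`. -/
structure IsSparseExpander (β K : ℝ) (n : ℕ) (A : Matrix (Fin n) (Fin n) (ZMod 2)) : Prop where
  full_rank : A.rank = n
  row_ones : ∀ i, (rowSupport A i).card = 3
  col_ones : ∀ j, ((Finset.univ.filter (fun i => A i j = 1)).card : ℝ) ≤ K * Real.logb β n
  expander : IsBoundaryExpander A (radius β n) 3 (11 / 13)

/-! ### Bad pairs -/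

/-- The pair `(i, j)` is bad: `i < j`, and for some right-hand side `b` some substitution of a
single variable in the formula of `A x = b`, `x_i ⊕ x_j = 0` gives an unsatisfiable formula that
has a tree-like resolution refutation of size less than `2 ^ (9 r / 130 - 3)`. -/
def IsBadPair {n : ℕ} (A : Matrix (Fin n) (Fin n) (ZMod 2)) (r : ℝ) (i j : Fin n) : Prop :=
  i < j ∧ ∃ (b : Fin n → ZMod 2) (v : Fin n) (a : ZMod 2),
    ¬ CNF.Satisfiable ((extendedCNF A i j b).subst v a) ∧
      ∃ π : Refutation ((extendedCNF A i j b).subst v a),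
        (π.size : ℝ) < (2 : ℝ) ^ (9 * r / 130 - 3)

end XorSys

/-!
Play the Prover–Delayer game for tree-like resolution, with a Delayer who keeps every small set of
equations jointly solvable together with the literals granted so far. If a small set of equations is
not solvable in this way, neither is a subset whose boundary lies inside the granted variables,
since a row with another boundary variable can be repaired by flipping that variable; by expansion
such a subset has few rows, so it suffices to control very few equations. The Delayer can therefore
survive any initial substitution, and a refutation is large, unless some nonempty small set of
equations has at most one boundary variable. Expansion of `A` forces such a set to consist of the
equation `x_i + x_j = 0` and at most three rows of `A`, and these rows then contain a chain joining
`i` to `j`. A chain is determined, up to a constant factor, by its middle row and by one row meeting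
it on either side, which leaves `O(n d ^ 2)` pairs for columns of weight at most `d`.
-/

namespace XorSys

open scoped Matrix

section TreeResolution

variable {V : Type} [DecidableEq V] {F : CNF V} {P : ℕ} {Q : Finset (Literal V) → Prop}

/-- A strategy for the Delayer in the Prover–Delayer game on `F`, given by the positions `Q` that
the Delayer considers safe; a position is the set of literals granted so far. As long as fewer
than `P` literals have been granted, every clause of `F` has a literal that can safely be granted
next. -/
structure IsDelayerStrategy (F : CNF V) (P : ℕ) (Q : Finset (Literal V) → Prop) : Prop where
  of_subset : ∀ {σ τ}, σ ⊆ τ → Q τ → Q σ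
  eq_of_mem : ∀ {σ v a a'}, Q σ → (v, a) ∈ σ → (v, a') ∈ σ → a = a'
  exists_insert : ∀ {σ C}, Q σ → σ.card < P → C ∈ F → ∃ l ∈ C, Q (insert l σ)

theorem IsDelayerStrategy.not_insert_insert (hQ : IsDelayerStrategy F P Q) {C : Clause V}
    {σ : Finset (Literal V)} {k : V} {a a' : ZMod 2} (ha : a ≠ a')
    (hC : ∀ l ∈ C, l ≠ (k, a) → ¬ Q (insert l σ)) :
    ∀ l ∈ C, ¬ Q (insert l (insert (k, a') σ)) := by
  intro l hl h
  rcases eq_or_ne l (k, a) with rfl | hne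
  · exact ha (hQ.eq_of_mem h (v := k) (by simp) (by simp))
  · exact hC l hl hne
      (hQ.of_subset (Finset.insert_subset_insert _ (Finset.subset_insert _ _)) h)

/-- A query without two safe answers is passed on to a single subtree. Only a query at which both
answers are safe uses up a granted literal, and there both subtrees are large. -/
theorem IsDelayerStrategy.two_pow_le_size_mul (hQ : IsDelayerStrategy F P Q) {C : Clause V}
    (π : ResTree F C) {σ : Finset (Literal V)} (hσ : Q σ) (hC : ∀ l ∈ C, ¬ Q (insert l σ)) :
    2 ^ P ≤ π.size * 2 ^ σ.card := by
  induction π generalizing σ with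
  | leaf C hCF =>
    rcases lt_or_ge σ.card P with hlt | hge
    · obtain ⟨l, hl, hQl⟩ := hQ.exists_insert hσ hlt hCF
      exact absurd hQl (hC l hl)
    · simpa only [ResTree.size, one_mul] using Nat.pow_le_pow_right two_pos hge
  | resolve k C D hkC hkD s t ihs iht =>
    have hC' : ∀ l ∈ C, l ≠ (k, 1) → ¬ Q (insert l σ) := fun l hl hne =>
      hC l (Finset.mem_union_left _ (Finset.mem_erase.2 ⟨hne, hl⟩))
    have hD' : ∀ l ∈ D, l ≠ (k, 0) → ¬ Q (insert l σ) := fun l hl hne =>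
      hC l (Finset.mem_union_right _ (Finset.mem_erase.2 ⟨hne, hl⟩))
    simp only [ResTree.size]
    by_cases h1 : Q (insert (k, 1) σ)
    swap
    · refine (ihs hσ fun l hl => ?_).trans (Nat.mul_le_mul_right _ (by omega))
      exact (eq_or_ne l (k, 1)).elim (fun h => h ▸ h1) (hC' l hl)
    by_cases h0 : Q (insert (k, 0) σ)
    swap
    · refine (iht hσ fun l hl => ?_).trans (Nat.mul_le_mul_right _ (by omega))
      exact (eq_or_ne l (k, 0)).elim (fun h => h ▸ h0) (hD' l hl)
    have two_pow_card_insert_le (l : Literal V) : 2 ^ (insert l σ).card ≤ 2 * 2 ^ σ.card := by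
      rw [← pow_succ']
      exact Nat.pow_le_pow_right two_pos (Finset.card_insert_le _ _)
    have hs := (ihs h0 (hQ.not_insert_insert one_ne_zero hC')).trans
      (Nat.mul_le_mul_left _ (two_pow_card_insert_le _))
    have ht := (iht h1 (hQ.not_insert_insert zero_ne_one hD')).trans
      (Nat.mul_le_mul_left _ (two_pow_card_insert_le _))
    calc 2 ^ P ≤ (s.size + t.size) * 2 ^ σ.card := by linarith
      _ ≤ (s.size + t.size + 1) * 2 ^ σ.card := Nat.mul_le_mul_right _ (Nat.le_succ _)

theorem IsDelayerStrategy.two_pow_le_size (hQ : IsDelayerStrategy F P Q) (h0 : Q ∅)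
    (π : Refutation F) : 2 ^ P ≤ π.size := by
  simpa using hQ.two_pow_le_size_mul π h0 (by simp)

theorem IsDelayerStrategy.subst (hQ : IsDelayerStrategy F (P + 1) Q) (v : V) (a : ZMod 2) :
    IsDelayerStrategy (F.subst v a) P fun σ => Q (insert (v, a) σ) where
  of_subset h := hQ.of_subset (Finset.insert_subset_insert _ h)
  eq_of_mem h hl hl' := hQ.eq_of_mem h (Finset.mem_insert_of_mem hl) (Finset.mem_insert_of_mem hl')
  exists_insert {σ C} hσ hcard hC := by
    simp only [CNF.subst, Finset.mem_image, Finset.mem_filter] at hC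
    obtain ⟨D, ⟨hD, -⟩, rfl⟩ := hC
    obtain ⟨l, hl, hQl⟩ :=
      hQ.exists_insert hσ ((Finset.card_insert_le _ _).trans_lt (by omega)) hD
    refine ⟨l, Finset.mem_erase.2 ⟨?_, hl⟩, by rwa [Finset.insert_comm]⟩
    rintro rfl
    have : a + 1 = a := hQ.eq_of_mem hQl (Finset.mem_insert_self _ _) (by simp)
    simp at this

theorem ResTree.one_le_size {C : Clause V} (π : ResTree F C) : 1 ≤ π.size := by
  cases π <;> simp [ResTree.size]

end TreeResolution

section Boundary

variable {R V : Type} [Fintype V] {M : Matrix R V (ZMod 2)} {I : Finset R} {s : R} {l : V}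

theorem mem_rowSupport : l ∈ rowSupport M s ↔ M s l = 1 := by
  simp [rowSupport]

theorem eq_zero_of_notMem_rowSupport (hl : l ∉ rowSupport M s) : M s l = 0 := by
  have eq_zero_or_one : ∀ c : ZMod 2, c = 0 ∨ c = 1 := by decide
  exact (eq_zero_or_one _).resolve_right (mem_rowSupport.not.1 hl)

theorem mulVec_eq_sum_rowSupport (M : Matrix R V (ZMod 2)) (x : V → ZMod 2) (s : R) :
    (M *ᵥ x) s = ∑ l ∈ rowSupport M s, x l := by
  rw [Matrix.mulVec, dotProduct, ← Finset.sum_subset (Finset.subset_univ (rowSupport M s))]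
  · exact Finset.sum_congr rfl fun l hl => by rw [mem_rowSupport.1 hl, one_mul]
  · exact fun l _ hl => by rw [eq_zero_of_notMem_rowSupport hl, zero_mul]

theorem mem_boundary_iff_existsUnique :
    l ∈ boundary M I ↔ ∃! s, s ∈ I ∧ l ∈ rowSupport M s := by
  simp [boundary, Finset.card_eq_one, Finset.singleton_iff_unique_mem, mem_rowSupport]

theorem rowSupport_subset_boundary (hs : s ∈ I)
    (hd : ∀ t ∈ I, t ≠ s → Disjoint (rowSupport M s) (rowSupport M t)) :
    rowSupport M s ⊆ boundary M I := fun _ hl =>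
  mem_boundary_iff_existsUnique.2 ⟨s, ⟨hs, hl⟩, fun t ht => by
    by_contra hts
    exact Finset.disjoint_left.1 (hd t ht.1 hts) hl ht.2⟩

theorem boundary_toLeft_subset {R' : Type} [DecidableEq V] (A : Matrix R V (ZMod 2))
    (B : Matrix R' V (ZMod 2)) (I : Finset (R ⊕ R')) :
    boundary A I.toLeft ⊆ boundary (Matrix.fromRows A B) I ∪ I.toRight.biUnion (rowSupport B) := by
  intro l hl
  obtain ⟨s, ⟨hs, hls⟩, huniq⟩ := mem_boundary_iff_existsUnique.1 hl
  by_cases hB : l ∈ I.toRight.biUnion (rowSupport B)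
  · exact Finset.mem_union_right _ hB
  refine Finset.mem_union_left _ (mem_boundary_iff_existsUnique.2
    ⟨Sum.inl s, ⟨Finset.mem_toLeft.1 hs, hls⟩, ?_⟩)
  rintro (t | t) ⟨ht, hlt⟩
  · exact congrArg Sum.inl (huniq t ⟨Finset.mem_toLeft.2 ht, hlt⟩)
  · exact absurd (Finset.mem_biUnion.2 ⟨t, Finset.mem_toRight.2 ht, hlt⟩) hB

/-- Flipping the boundary variable `l` repairs its row without touching the other rows of `I`. -/
theorem exists_eqOn_of_mem_boundary (b : R → ZMod 2) (hl : l ∈ boundary M I) :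
    ∃ s ∈ I, ∀ x : V → ZMod 2, (∀ t ∈ I, t ≠ s → (M *ᵥ x) t = b t) →
      ∃ y, Set.EqOn y x {l}ᶜ ∧ Set.EqOn (M *ᵥ y) b I := by
  classical
  obtain ⟨s, ⟨hs, hls⟩, huniq⟩ := mem_boundary_iff_existsUnique.1 hl
  refine ⟨s, hs, fun x hx => ⟨x + Pi.single l (b s - (M *ᵥ x) s), fun k hk => ?_, fun t ht => ?_⟩⟩
  · simp [Pi.single_eq_of_ne (show k ≠ l from hk)]
  · rw [Matrix.mulVec_add, Pi.add_apply, Matrix.mulVec_single]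
    rcases eq_or_ne t s with rfl | hts
    · simp [mem_rowSupport.1 hls]
    · have : M t l = 0 := eq_zero_of_notMem_rowSupport fun h => hts (huniq t ⟨ht, h⟩)
      simp [this, hx t ht hts]

/-- Peel off rows owning a boundary variable outside `T` until none is left. -/
theorem exists_subset_boundary_subset (M : Matrix R V (ZMod 2)) (b : R → ZMod 2) (T : Finset V)
    (I : Finset R) : ∃ I' ⊆ I, boundary M I' ⊆ T ∧ ∀ x : V → ZMod 2, Set.EqOn (M *ᵥ x) b I' →
      ∃ y, Set.EqOn y x T ∧ Set.EqOn (M *ᵥ y) b I := by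
  classical
  induction I using Finset.strongInduction with
  | H I ih =>
    by_cases hT : boundary M I ⊆ T
    · exact ⟨I, subset_rfl, hT, fun x hx => ⟨x, fun _ _ => rfl, hx⟩⟩
    obtain ⟨l, hl, hlT⟩ := Finset.not_subset.1 hT
    obtain ⟨s, hs, repair⟩ := exists_eqOn_of_mem_boundary b hl
    obtain ⟨I', hI', hbd, extend⟩ := ih _ (Finset.erase_ssubset hs)
    refine ⟨I', hI'.trans (Finset.erase_subset _ _), hbd, fun x hx => ?_⟩
    obtain ⟨y, hyx, hy⟩ := extend x hx
    obtain ⟨z, hzy, hz⟩ := repair y fun t ht hts => hy (by simp [ht, hts])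
    exact ⟨z, fun k hk => (hzy fun h => hlT (h ▸ hk)).trans (hyx hk), hz⟩

end Boundary

section LocalConsistency

variable {R V : Type} [Fintype V] {M : Matrix R V (ZMod 2)} {b : R → ZMod 2} {N P q w : ℕ}
  {σ τ : Finset (Literal V)}

/-- Any `N` equations of the system `M x = b` have a common solution that satisfies all the
literals in `σ`. -/
def LocallyConsistent (M : Matrix R V (ZMod 2)) (b : R → ZMod 2) (N : ℕ)
    (σ : Finset (Literal V)) : Prop :=
  ∀ I : Finset R, I.card ≤ N → ∃ x : V → ZMod 2, (∀ l ∈ σ, x l.1 = l.2) ∧ Set.EqOn (M *ᵥ x) b I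

theorem LocallyConsistent.of_subset (hτ : LocallyConsistent M b N τ) (h : σ ⊆ τ) :
    LocallyConsistent M b N σ := fun I hI =>
  let ⟨x, hx, hxI⟩ := hτ I hI
  ⟨x, fun l hl => hx l (h hl), hxI⟩

theorem LocallyConsistent.eq_of_mem (hσ : LocallyConsistent M b N σ) {v : V} {a a' : ZMod 2}
    (h : (v, a) ∈ σ) (h' : (v, a') ∈ σ) : a = a' :=
  let ⟨_, hx, _⟩ := hσ ∅ (Nat.zero_le N)
  (hx _ h).symm.trans (hx _ h')

theorem LocallyConsistent.of_card_boundary_le (hσ : LocallyConsistent M b q σ)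
    (hexp : ∀ I : Finset R, I.card ≤ N → (boundary M I).card ≤ σ.card → I.card ≤ q) :
    LocallyConsistent M b N σ := by
  classical
  intro I hI
  obtain ⟨I', hI', hbd, extend⟩ := exists_subset_boundary_subset M b (σ.image Prod.fst) I
  have hcard : I'.card ≤ q := hexp I' ((Finset.card_le_card hI').trans hI)
    ((Finset.card_le_card hbd).trans Finset.card_image_le)
  obtain ⟨x, hxσ, hx⟩ := hσ I' hcard
  obtain ⟨y, hyx, hy⟩ := extend x hx
  exact ⟨y, fun l hl => (hyx (Finset.mem_image_of_mem _ hl)).trans (hxσ l hl), hy⟩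

variable [DecidableEq V]

theorem card_le_of_mem_parityCNF {S : Finset V} {a : ZMod 2} {C : Clause V}
    (hC : C ∈ parityCNF S a) : C.card ≤ S.card := by
  obtain ⟨y, -, rfl⟩ := Finset.mem_image.1 hC
  exact Finset.card_image_le

theorem satisfiedBy_of_mem_parityCNF {S : Finset V} {a : ZMod 2} {C : Clause V}
    (hC : C ∈ parityCNF S a) {x : V → ZMod 2} (hx : ∑ v ∈ S, x v = a) : C.SatisfiedBy x := by
  obtain ⟨y, hy, rfl⟩ := Finset.mem_image.1 hC
  have eq_or_eq_add_one : ∀ c d : ZMod 2, c = d ∨ c = d + 1 := by decide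
  obtain ⟨v, hv, hvy⟩ : ∃ v ∈ S, x v ≠ y v := by
    by_contra! h
    exact (Finset.mem_filter.1 hy).2 (Finset.sum_congr rfl h ▸ hx)
  exact ⟨_, Finset.mem_image_of_mem _ hv, (eq_or_eq_add_one _ _).resolve_left hvy⟩

variable [Fintype R]

/-- If every literal of `C` were refuted by `q` equations, these together with the equation of `C`
would be inconsistent. -/
theorem LocallyConsistent.exists_insert (hσ : LocallyConsistent M b N σ)
    (hrow : ∀ i, (rowSupport M i).card ≤ w) (hN : 1 + w * q ≤ N) {C : Clause V}
    (hC : C ∈ systemCNF M b) : ∃ l ∈ C, LocallyConsistent M b q (insert l σ) := by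
  classical
  obtain ⟨i, -, hCi⟩ := Finset.mem_biUnion.1 hC
  by_contra! hrefuted
  simp only [LocallyConsistent, not_forall] at hrefuted
  choose! J hJ hJσ using hrefuted
  have hcard : (insert i (C.biUnion J)).card ≤ N := calc
    (insert i (C.biUnion J)).card ≤ (C.biUnion J).card + 1 := Finset.card_insert_le _ _
    _ ≤ C.card * q + 1 := by gcongr; exact Finset.card_biUnion_le_card_mul _ _ _ hJ
    _ ≤ w * q + 1 := by gcongr; exact (card_le_of_mem_parityCNF hCi).trans (hrow i)
    _ ≤ N := by omega
  obtain ⟨x, hxσ, hx⟩ := hσ _ hcard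
  obtain ⟨l, hl, hxl⟩ := satisfiedBy_of_mem_parityCNF hCi (x := x) (by
    rw [← mulVec_eq_sum_rowSupport]
    exact hx (Finset.mem_insert_self _ _))
  exact hJσ l hl ⟨x, (Finset.forall_mem_insert _ _ _).2 ⟨hxl, hxσ⟩, fun t ht =>
    hx (Finset.mem_insert_of_mem (Finset.mem_biUnion.2 ⟨l, hl, ht⟩))⟩

theorem isDelayerStrategy_locallyConsistent (b : R → ZMod 2)
    (hrow : ∀ i, (rowSupport M i).card ≤ w) (hN : 1 + w * q ≤ N)
    (hexp : ∀ I : Finset R, I.card ≤ N → (boundary M I).card ≤ P → I.card ≤ q) :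
    IsDelayerStrategy (systemCNF M b) P (LocallyConsistent M b N) where
  of_subset h hτ := hτ.of_subset h
  eq_of_mem hσ := hσ.eq_of_mem
  exists_insert {σ C} hσ hcard hC := by
    obtain ⟨l, hl, hlσ⟩ := hσ.exists_insert hrow hN hC
    refine ⟨l, hl, hlσ.of_card_boundary_le fun I hI hbd => hexp I hI (hbd.trans ?_)⟩
    exact (Finset.card_insert_le _ _).trans hcard

theorem two_pow_le_size_of_expansion (hrow : ∀ i, (rowSupport M i).card ≤ w)
    (hN : 1 + w * q ≤ N)
    (hexp : ∀ I : Finset R, I.card ≤ N → (boundary M I).card ≤ P + 1 → I.card ≤ q)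
    (hone : ∀ I : Finset R, I.card ≤ N → (boundary M I).card ≤ 1 → I = ∅) {v : V} {a : ZMod 2}
    (π : Refutation ((systemCNF M b).subst v a)) : 2 ^ P ≤ π.size := by
  have hstart : LocallyConsistent M b 0 {(v, a)} := fun I hI =>
    ⟨fun _ => a, by simp, by simp [Finset.card_eq_zero.1 (Nat.le_zero.1 hI)]⟩
  refine ((isDelayerStrategy_locallyConsistent b hrow hN hexp).subst v a).two_pow_le_size ?_ π
  exact hstart.of_card_boundary_le fun I hI hbd => by simp [hone I hI (by simpa using hbd)]

end LocalConsistency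

section PairExtension

/-- The matrix `A` with the additional row `e_i + e_j`, the matrix underlying `extendedCNF`. -/
abbrev pairExtension {R V : Type} [DecidableEq V] (A : Matrix R V (ZMod 2))
    (i j : V) : Matrix (R ⊕ Unit) V (ZMod 2) :=
  Matrix.fromRows A (Matrix.of fun _ : Unit => Pi.single i 1 + Pi.single j 1)

theorem pairExtension_comm {R V : Type} [DecidableEq V] (A : Matrix R V (ZMod 2)) (i j : V) :
    pairExtension A i j = pairExtension A j i := by
  simp only [pairExtension, add_comm]

variable {R V : Type} [Fintype V] {A : Matrix R V (ZMod 2)} {r c : ℝ} {i j : V}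

/-- The variables `i` and `j` are joined by a chain of at most three rows of `A`, in which
consecutive rows share a variable. Rows may repeat, which covers the shorter chains. -/
def Near (A : Matrix R V (ZMod 2)) (i j : V) : Prop :=
  ∃ s t u, i ∈ rowSupport A s ∧ ¬ Disjoint (rowSupport A s) (rowSupport A t) ∧
    ¬ Disjoint (rowSupport A t) (rowSupport A u) ∧ j ∈ rowSupport A u

/-- Starting the count at a row of the chain instead of at the variable `i` saves a factor `d`. -/
theorem ncard_near_le [Fintype R] {w d : ℕ} (hrow : ∀ s, (rowSupport A s).card ≤ w)
    (hcol : ∀ l, (Finset.univ.filter fun s => A s l = 1).card ≤ d) :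
    {p : V × V | Near A p.1 p.2}.ncard ≤ Fintype.card R * (w * w * (d * w * (d * w))) := by
  classical
  let neighbors (l : V) : Finset V :=
    (Finset.univ.filter fun s => A s l = 1).biUnion (rowSupport A)
  have card_neighbors (l : V) : (neighbors l).card ≤ d * w :=
    (Finset.card_biUnion_le_card_mul _ _ w fun s _ => hrow s).trans
      (Nat.mul_le_mul_right w (hcol l))
  let pairsThrough (t : R) : Finset (V × V) :=
    (rowSupport A t ×ˢ rowSupport A t).biUnion fun m => neighbors m.1 ×ˢ neighbors m.2
  have card_pairsThrough (t : R) : (pairsThrough t).card ≤ w * w * (d * w * (d * w)) := by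
    refine (Finset.card_biUnion_le_card_mul _ _ _ fun m _ => ?_).trans (Nat.mul_le_mul_right _ ?_)
    · rw [Finset.card_product]
      exact Nat.mul_le_mul (card_neighbors _) (card_neighbors _)
    · rw [Finset.card_product]
      exact Nat.mul_le_mul (hrow t) (hrow t)
  have near_subset : {p : V × V | Near A p.1 p.2} ⊆ Finset.univ.biUnion pairsThrough := by
    rintro ⟨i, j⟩ ⟨s, t, u, hi, hst, htu, hj⟩
    obtain ⟨k, hks, hkt⟩ := Finset.not_disjoint_iff.1 hst
    obtain ⟨l, hlt, hlu⟩ := Finset.not_disjoint_iff.1 htu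
    rw [mem_rowSupport] at hks hlu
    simp only [pairsThrough, neighbors, Finset.coe_biUnion, Set.mem_iUnion, Finset.mem_coe,
      Finset.mem_biUnion, Finset.mem_product, Finset.mem_filter, Finset.mem_univ, true_and,
      exists_prop]
    exact ⟨t, (k, l), ⟨hkt, hlt⟩, ⟨s, hks, hi⟩, ⟨u, hlu, hj⟩⟩
  refine (Set.ncard_le_ncard near_subset (Finset.finite_toSet _)).trans ?_
  rw [Set.ncard_coe_finset]
  exact Finset.card_biUnion_le_card_mul _ _ _ fun t _ => card_pairsThrough t

theorem near_of_boundary_subset (hrow : ∀ s, (rowSupport A s).card = 3) {I : Finset R}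
    (hI : I.card ≤ 3) {S : Finset V} (hS : S.card ≤ 3) (hbd : boundary A I ⊆ S) (hiS : i ∈ S)
    (hjS : j ∈ S) {s u : R} (hs : s ∈ I) (hi : i ∈ rowSupport A s) (hu : u ∈ I)
    (hj : j ∈ rowSupport A u) : Near A i j := by
  classical
  have meets_self (t : R) : ¬ Disjoint (rowSupport A t) (rowSupport A t) := by
    rw [disjoint_self, Finset.bot_eq_empty, ← Finset.card_eq_zero, hrow]
    norm_num
  by_contra hnear
  have exists_meets : ∀ t ∈ I, ∃ m ∈ I, m ≠ t ∧ ¬ Disjoint (rowSupport A t) (rowSupport A m) := by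
    intro t ht
    by_contra! hisolated
    have : rowSupport A t = S := Finset.eq_of_subset_of_card_le
      ((rowSupport_subset_boundary ht hisolated).trans hbd) (by rwa [hrow])
    exact hnear ⟨t, t, t, this ▸ hiS, meets_self t, meets_self t, this ▸ hjS⟩
  have hdisj : Disjoint (rowSupport A s) (rowSupport A u) :=
    not_not.1 fun h => hnear ⟨s, s, u, hi, meets_self s, h, hj⟩
  have hsu : s ≠ u := by rintro rfl; exact meets_self s hdisj
  obtain ⟨t, ht, hts, hst⟩ := exists_meets s hs
  obtain ⟨m, hm, hmu, hum⟩ := exists_meets u hu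
  have htu : t ≠ u := by rintro rfl; exact hst hdisj
  have hms : m ≠ s := by rintro rfl; exact hum hdisj.symm
  have hrest : ((I.erase s).erase u).card ≤ 1 := by
    rw [Finset.card_erase_of_mem (by simp [hu, hsu.symm]), Finset.card_erase_of_mem hs]
    omega
  obtain rfl : t = m := Finset.card_le_one.1 hrest t (by simp [ht, hts, htu]) m
    (by simp [hm, hmu, hms])
  exact hnear ⟨s, t, u, hi, hst, fun h => hum h.symm, hj⟩

theorem IsBoundaryExpander.eq_empty_of_card_boundary_le_one {w : ℕ}
    (hA : IsBoundaryExpander A r w c) (hc : 1 / 2 < c) (hrow : ∀ s, 1 < (rowSupport A s).card)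
    {I : Finset R} (hI : (I.card : ℝ) ≤ r) (hbd : (boundary A I).card ≤ 1) : I = ∅ := by
  have hcI := hA.2 I hI
  have hbd' : ((boundary A I).card : ℝ) ≤ 1 := by exact_mod_cast hbd
  have hlt : (I.card : ℝ) < 2 := by
    by_contra! h
    nlinarith
  by_contra hne
  have hone : I.card = 1 := by
    have := Finset.card_pos.2 (Finset.nonempty_iff_ne_empty.2 hne)
    have : I.card < 2 := by exact_mod_cast hlt
    omega
  obtain ⟨s, rfl⟩ := Finset.card_eq_one.1 hone
  have hsub : rowSupport A s ⊆ boundary A {s} :=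
    rowSupport_subset_boundary (Finset.mem_singleton_self s) (by simp)
  exact absurd ((Finset.card_le_card hsub).trans hbd) (hrow s).not_ge

variable [DecidableEq V]

theorem rowSupport_pairExtension_inr (hij : i ≠ j) :
    rowSupport (pairExtension A i j) (Sum.inr ()) = {i, j} := by
  ext l
  rcases eq_or_ne l i with rfl | hi
  · simp [mem_rowSupport, hij]
  · simp [mem_rowSupport, hi, Pi.single_apply]

theorem card_rowSupport_pairExtension_le (hrow : ∀ s, (rowSupport A s).card ≤ 3) (hij : i ≠ j)
    (s : R ⊕ Unit) : (rowSupport (pairExtension A i j) s).card ≤ 3 := by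
  rcases s with s | ⟨⟩
  · exact hrow s
  · rw [rowSupport_pairExtension_inr hij]
    exact Finset.card_le_two.trans (by norm_num)

theorem boundary_toLeft_subset_pairExtension (hij : i ≠ j) (I : Finset (R ⊕ Unit)) :
    boundary A I.toLeft ⊆ boundary (pairExtension A i j) I ∪ {i, j} := by
  refine (boundary_toLeft_subset A _ I).trans (Finset.union_subset_union_right ?_)
  exact Finset.biUnion_subset.2 fun _ _ => (rowSupport_pairExtension_inr (A := A) hij).subset

theorem IsBoundaryExpander.mul_card_toLeft_le {w : ℕ} (hA : IsBoundaryExpander A r w c)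
    (hij : i ≠ j) {I : Finset (R ⊕ Unit)} (hI : (I.card : ℝ) ≤ r) :
    c * I.toLeft.card ≤ (boundary (pairExtension A i j) I).card + 2 := by
  have hle := (Finset.card_le_card (boundary_toLeft_subset_pairExtension (A := A) hij I)).trans
    (Finset.card_union_le _ _)
  rw [Finset.card_pair hij] at hle
  calc c * I.toLeft.card ≤ (boundary A I.toLeft).card :=
        hA.2 _ ((Nat.cast_le.2 Finset.card_toLeft_le).trans hI)
    _ ≤ (boundary (pairExtension A i j) I).card + 2 := by exact_mod_cast hle

theorem mem_boundary_pairExtension (hij : i ≠ j) {I : Finset (R ⊕ Unit)} (hI : Sum.inr () ∈ I)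
    {l : V} (hl : l = i ∨ l = j) (huncov : ∀ s ∈ I.toLeft, l ∉ rowSupport A s) :
    l ∈ boundary (pairExtension A i j) I := by
  refine mem_boundary_iff_existsUnique.2
    ⟨Sum.inr (), ⟨hI, by simpa [rowSupport_pairExtension_inr hij] using hl⟩, ?_⟩
  rintro (s | ⟨⟩) ⟨hs, hls⟩
  · exact absurd hls (huncov s (Finset.mem_toLeft.2 hs))
  · rfl

/-- If `i` were uncovered, it would be the only boundary variable of `I`, so that the rows of `A`
in `I` would have boundary at most `{j}`; hence there would be none, and `j` would be a second
boundary variable. -/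
theorem IsBoundaryExpander.exists_mem_rowSupport_left {w : ℕ} (hA : IsBoundaryExpander A r w c)
    (hc : 1 / 2 < c) (hrow : ∀ s, 1 < (rowSupport A s).card) (hij : i ≠ j)
    {I : Finset (R ⊕ Unit)} (hI : (I.card : ℝ) ≤ r) (hinr : Sum.inr () ∈ I)
    (hbd : (boundary (pairExtension A i j) I).card ≤ 1) :
    ∃ s ∈ I.toLeft, i ∈ rowSupport A s := by
  by_contra! huncov
  have hi := mem_boundary_pairExtension hij hinr (Or.inl rfl) huncov
  have hsub : boundary A I.toLeft ⊆ {j} := fun l hl => by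
    have hli : l ≠ i := by
      rintro rfl
      obtain ⟨s, ⟨hs, hls⟩, -⟩ := mem_boundary_iff_existsUnique.1 hl
      exact huncov s hs hls
    have hl' := boundary_toLeft_subset_pairExtension hij I hl
    have hlbd : l ∉ boundary (pairExtension A i j) I := fun h =>
      hli (Finset.card_le_one.1 hbd l h i hi)
    simpa [hlbd, hli] using hl'
  have hempty : I.toLeft = ∅ := hA.eq_empty_of_card_boundary_le_one hc hrow
    ((Nat.cast_le.2 Finset.card_toLeft_le).trans hI) (Finset.card_le_card hsub)
  have hj := mem_boundary_pairExtension (A := A) hij hinr (Or.inr rfl) (by simp [hempty])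
  exact hij (Finset.card_le_one.1 hbd i hi j hj)

theorem IsBoundaryExpander.eq_empty_of_card_boundary_pairExtension_le_one {w : ℕ}
    (hA : IsBoundaryExpander A r w c) (hc : 3 / 4 < c) (hrow : ∀ s, (rowSupport A s).card = 3)
    (hij : i ≠ j) (hnear : ¬ Near A i j) {I : Finset (R ⊕ Unit)} (hI : (I.card : ℝ) ≤ r)
    (hbd : (boundary (pairExtension A i j) I).card ≤ 1) : I = ∅ := by
  have hc' : 1 / 2 < c := by linarith
  have hrow' : ∀ s, 1 < (rowSupport A s).card := fun s => by simp [hrow s]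
  by_cases hinr : Sum.inr () ∈ I
  · obtain ⟨s, hs, his⟩ := hA.exists_mem_rowSupport_left hc' hrow' hij hI hinr hbd
    obtain ⟨u, hu, hju⟩ := hA.exists_mem_rowSupport_left hc' hrow' hij.symm hI hinr
      (pairExtension_comm A i j ▸ hbd)
    have hcard : I.toLeft.card ≤ 3 := by
      have hle := hA.mul_card_toLeft_le hij hI
      have hbd' : ((boundary (pairExtension A i j) I).card : ℝ) ≤ 1 := by exact_mod_cast hbd
      have hlt : (I.toLeft.card : ℝ) < 4 := by nlinarith
      exact Nat.le_of_lt_succ (by exact_mod_cast hlt)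
    have hS : (boundary (pairExtension A i j) I ∪ {i, j}).card ≤ 3 :=
      (Finset.card_union_le _ _).trans (Nat.add_le_add hbd Finset.card_le_two)
    exact absurd (near_of_boundary_subset hrow hcard hS
      (boundary_toLeft_subset_pairExtension hij I) (by simp) (by simp) hs his hu hju) hnear
  · have hright : I.toRight = ∅ :=
      Finset.eq_empty_of_forall_notMem fun t ht => hinr (Finset.mem_toRight.1 ht)
    have hsub : boundary A I.toLeft ⊆ boundary (pairExtension A i j) I := by
      simpa [hright] using boundary_toLeft_subset A _ I
    have hleft : I.toLeft = ∅ := hA.eq_empty_of_card_boundary_le_one hc' hrow'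
      ((Nat.cast_le.2 Finset.card_toLeft_le).trans hI) ((Finset.card_le_card hsub).trans hbd)
    simpa [hleft, hright] using (Finset.card_toLeft_add_card_toRight (u := I)).symm

variable [Fintype R] {b : R ⊕ Unit → ZMod 2} {v : V} {a : ZMod 2}

/-- A set of at most `r` rows with boundary at most `P + 1` has at most `4 (P + 3) / 3` rows in `A`,
hence at most `2 P + 5` rows; clauses have width three, so `1 + 3 (2 P + 5)` rows have to be
consistent. -/
theorem IsBoundaryExpander.two_pow_le_size_of_not_near (hA : IsBoundaryExpander A r 3 c)
    (hc : 3 / 4 < c) (hrow : ∀ s, (rowSupport A s).card = 3) (hij : i ≠ j) (hnear : ¬ Near A i j)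
    {P : ℕ} (hP : 6 * P + 16 ≤ r)
    (π : Refutation ((systemCNF (pairExtension A i j) b).subst v a)) : 2 ^ P ≤ π.size := by
  have hr {I : Finset (R ⊕ Unit)} (hI : I.card ≤ 1 + 3 * (2 * P + 5)) : (I.card : ℝ) ≤ r := by
    refine le_trans ?_ hP
    exact_mod_cast hI.trans (by omega)
  refine two_pow_le_size_of_expansion (q := 2 * P + 5)
    (card_rowSupport_pairExtension_le (fun s => (hrow s).le) hij) le_rfl ?_ ?_ π
  · intro I hI hbd
    have hle := hA.mul_card_toLeft_le hij (hr hI)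
    have hbd' : ((boundary (pairExtension A i j) I).card : ℝ) ≤ P + 1 := by exact_mod_cast hbd
    have hleft : (3 * I.toLeft.card : ℝ) ≤ 4 * (P + 3) := by nlinarith
    have hleft' : 3 * I.toLeft.card ≤ 4 * (P + 3) := by exact_mod_cast hleft
    have hright : I.toRight.card ≤ 1 := Finset.card_le_univ _
    have hsum := Finset.card_toLeft_add_card_toRight (u := I)
    omega
  · exact fun I hI => hA.eq_empty_of_card_boundary_pairExtension_le_one hc hrow hij hnear (hr hI)

theorem IsBoundaryExpander.two_rpow_le_size_of_not_near (hA : IsBoundaryExpander A r 3 c)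
    (hc : 3 / 4 < c) (hrow : ∀ s, (rowSupport A s).card = 3) (hij : i ≠ j) (hnear : ¬ Near A i j)
    (π : Refutation ((systemCNF (pairExtension A i j) b).subst v a)) :
    (2 : ℝ) ^ (9 * r / 130 - 3) ≤ π.size := by
  rcases le_or_gt (9 * r / 130 - 3) 0 with hsmall | hlarge
  · calc (2 : ℝ) ^ (9 * r / 130 - 3) ≤ 1 :=
          Real.rpow_le_one_of_one_le_of_nonpos one_le_two hsmall
      _ ≤ π.size := by exact_mod_cast π.one_le_size
  have hceil := Nat.ceil_lt_add_one hlarge.le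
  calc (2 : ℝ) ^ (9 * r / 130 - 3) ≤ (2 : ℝ) ^ (⌈9 * r / 130 - 3⌉₊ : ℝ) :=
        Real.rpow_le_rpow_of_exponent_le one_le_two (Nat.le_ceil _)
    _ = ((2 ^ ⌈9 * r / 130 - 3⌉₊ : ℕ) : ℝ) := by rw [Real.rpow_natCast]; norm_cast
    _ ≤ π.size := Nat.cast_le.2
        (hA.two_pow_le_size_of_not_near hc hrow hij hnear (by linarith) π)

end PairExtension

theorem IsBadPair.near {n : ℕ} {A : Matrix (Fin n) (Fin n) (ZMod 2)} {r c : ℝ} {i j : Fin n}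
    (hbad : IsBadPair A r i j) (hA : IsBoundaryExpander A r 3 c) (hc : 3 / 4 < c)
    (hrow : ∀ s, (rowSupport A s).card = 3) : Near A i j := by
  obtain ⟨hij, b, v, a, -, π, hπ⟩ := hbad
  by_contra hnear
  exact hπ.not_ge (hA.two_rpow_le_size_of_not_near hc hrow hij.ne hnear π)

end XorSys

theorem mainTheorem6_general {n : ℕ} {A : Matrix (Fin n) (Fin n) (ZMod 2)} {r c d : ℝ}
    (hA : XorSys.IsBoundaryExpander A r 3 c) (hc : 3 / 4 < c)
    (hrow : ∀ s, (XorSys.rowSupport A s).card = 3)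
    (hcol : ∀ l, ((Finset.univ.filter fun s => A s l = 1).card : ℝ) ≤ d) :
    ({p : Fin n × Fin n | XorSys.IsBadPair A r p.1 p.2}.ncard : ℝ) ≤ 81 * (n * d ^ 2) := by
  rcases isEmpty_or_nonempty (Fin n) with _ | ⟨⟨l⟩⟩
  · simp [Set.eq_empty_of_isEmpty, Nat.cast_nonneg, mul_nonneg, sq_nonneg]
  have hd : 0 ≤ d := (Nat.cast_nonneg _).trans (hcol l)
  have hbad : {p : Fin n × Fin n | XorSys.IsBadPair A r p.1 p.2} ⊆
      {p | XorSys.Near A p.1 p.2} := fun p hp => hp.near hA hc hrow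
  have hnear := XorSys.ncard_near_le (fun s => (hrow s).le) fun l => Nat.le_floor (hcol l)
  calc ({p : Fin n × Fin n | XorSys.IsBadPair A r p.1 p.2}.ncard : ℝ)
      ≤ {p : Fin n × Fin n | XorSys.Near A p.1 p.2}.ncard :=
        Nat.cast_le.2 (Set.ncard_le_ncard hbad)
    _ ≤ n * (3 * 3 * (⌊d⌋₊ * 3 * (⌊d⌋₊ * 3))) := by
        rw [Fintype.card_fin] at hnear
        exact_mod_cast hnear
    _ = 81 * (n * (⌊d⌋₊ : ℝ) ^ 2) := by ring
    _ ≤ 81 * (n * d ^ 2) := by gcongr; exact Nat.floor_le hd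

theorem mainTheorem6 (β : ℝ) (hβ : 1 < β) (K : ℝ) :
    ∃ C : ℝ, ∀ (n : ℕ) (A : Matrix (Fin n) (Fin n) (ZMod 2)),
      XorSys.IsSparseExpander β K n A →
        (({p : Fin n × Fin n | XorSys.IsBadPair A (XorSys.radius β n) p.1 p.2}.ncard : ℕ) : ℝ)
          ≤ C * ((n : ℝ) * (Real.logb β n) ^ 2) := by
  refine ⟨81 * K ^ 2, fun n A hA => ?_⟩
  exact (mainTheorem6_general hA.expander (by norm_num) hA.row_ones hA.col_ones).trans_eq (by ring)
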